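/- Work in the plane $\mathbb R^2$. Let $\mathcal T=(T_1,\dots,T_m)$ be a sequence of triangles (three-element sets of nodes) such that, for each $i\ge 2$, $T_i$ shares exactly one edge with exactly one $T_j$ with $j<i$, and the node of $T_i$ opposite to this edge, called the pendant of $T_i$, lies in no earlier triangle. The union $G(\mathcal T)$ of the triangles is called a triangle tree. A leaf triangle is a triangle $T_i$ that shares an edge with exactly one other triangle of $\mathcal T$; its node opposite to this edge is called a leaf knot. A triangle notch is a graph obtained from a triangle tree $G(\mathcal T)$ by adding one new node $v$ (the apex), joined to nodes of $G(\mathcal T)$ in such a way that $v$ is adjacent to at least three nodes each of which is a pendant or a leaf knot, and $v$ is adjacent to all leaf knots of $G(\mathcal T)$. Every triangle notch $G=(V,E)$ is generically globally rigid: if $p:V\to\mathbb R^2$ is a generic configuration, that is, no non-zero polynomial with integer coefficients vanishes at the family of the $2|V|$ coordinates of the points $p(u)$, $u\in V$, and $q:V\to\mathbb R^2$ is any map with $|q(u)-q(w)|=|p(u)-p(w)|$ for all $\{u,w\}\in E$, then $|q(u)-q(w)|=|p(u)-p(w)|$ for all $u,w\in V$. -/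

import Mathlib

/-- The Euclidean plane. -/
abbrev Plane : Type := EuclideanSpace ℝ (Fin 2)

/-- A configuration of points in the plane is generic if the coordinates of all its points are
not algebraically dependent: no non-zero polynomial with integer coefficients vanishes at them. -/
def IsGenericConfig {V : Type*} (p : V → Plane) : Prop :=
  AlgebraicIndependent ℤ (fun c : V × Fin 2 => p c.1 c.2)

/-- Two configurations give every edge of `G` the same length. -/
def SameEdgeLengths {V : Type*} (G : SimpleGraph V) (p q : V → Plane) : Prop :=
  ∀ u v, G.Adj u v → dist (q u) (q v) = dist (p u) (p v)

/-- Two configurations are congruent: all pairwise distances agree. -/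
def CongruentConfig {V : Type*} (p q : V → Plane) : Prop :=
  ∀ u v, dist (q u) (q v) = dist (p u) (p v)

/-- `G` is generically globally rigid (in the plane): whatever the edge lengths are, a generic
realization of `G` is congruent to every placement of the vertices with the same edge lengths.
The second placement is arbitrary: it need be neither generic nor injective. -/
def GenericallyGloballyRigid {V : Type*} (G : SimpleGraph V) : Prop :=
  ∀ p : V → Plane, IsGenericConfig p →
    ∀ q : V → Plane, SameEdgeLengths G p q → CongruentConfig p q

/-- Two triangles (three-element sets of nodes) share exactly one edge. -/
def SharesEdge {V : Type*} [DecidableEq V] (S T : Finset V) : Prop :=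
  (S ∩ T).card = 2

/-- A sequence of triangles in which every triangle but the first shares exactly one edge with
exactly one earlier triangle, the node opposite to that edge being a new node. -/
structure IsTriangleTree {V : Type*} [DecidableEq V] {m : ℕ} (T : Fin m → Finset V) : Prop where
  card_eq_three : ∀ i, (T i).card = 3
  attached : ∀ i : Fin m, 0 < i.val → ∃! j : Fin m, j < i ∧ SharesEdge (T j) (T i)
  new_node : ∀ i j : Fin m, j < i → SharesEdge (T j) (T i) →
    ∀ u ∈ T i, u ∉ T j → ∀ k < i, u ∉ T k

/-- `u` is the pendant of `T i`: the node opposite to the edge shared with an earlier triangle. -/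
def IsPendant {V : Type*} [DecidableEq V] {m : ℕ} (T : Fin m → Finset V) (i : Fin m) (u : V) :
    Prop :=
  u ∈ T i ∧ ∃ j < i, SharesEdge (T j) (T i) ∧ u ∉ T j

/-- `T i` is a leaf triangle: it shares an edge with exactly one other triangle. -/
def IsLeafTriangle {V : Type*} [DecidableEq V] {m : ℕ} (T : Fin m → Finset V) (i : Fin m) :
    Prop :=
  ∃! j : Fin m, j ≠ i ∧ SharesEdge (T j) (T i)

/-- `u` is a leaf knot: the node of a leaf triangle opposite to its shared edge. -/
def IsLeafKnot {V : Type*} [DecidableEq V] {m : ℕ} (T : Fin m → Finset V) (u : V) : Prop :=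
  ∃ i, IsLeafTriangle T i ∧ u ∈ T i ∧ ∃ j, j ≠ i ∧ SharesEdge (T j) (T i) ∧ u ∉ T j

/-- The union of the triangles of a sequence, as a graph. -/
def triangleUnion {V : Type*} {m : ℕ} (T : Fin m → Finset V) : SimpleGraph V where
  Adj x y := x ≠ y ∧ ∃ i, x ∈ T i ∧ y ∈ T i
  symm := ⟨fun _ _ h => ⟨h.1.symm, h.2.imp fun _ hi => ⟨hi.2, hi.1⟩⟩⟩
  loopless := ⟨fun _ h => h.1 rfl⟩

/-- `G` is the triangle notch with triangle tree `T` and apex `v`: `G` arises from the union of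
the triangles by adding the single node `v`, where `v` is adjacent to at least three pendants
(leaf knots included) and to every leaf knot. -/
structure IsTriangleNotchOf {V : Type*} [DecidableEq V] (G : SimpleGraph V) {m : ℕ}
    (T : Fin m → Finset V) (v : V) : Prop where
  tree : IsTriangleTree T
  apex_outside : ∀ i, v ∉ T i
  covers : ∀ x, x ≠ v → ∃ i, x ∈ T i
  adj_iff : ∀ x y, x ≠ v → y ≠ v → (G.Adj x y ↔ (triangleUnion T).Adj x y)
  extended : ∃ S : Finset V, 3 ≤ S.card ∧
    ∀ u ∈ S, G.Adj v u ∧ ((∃ i, IsPendant T i u) ∨ IsLeafKnot T u)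
  leafKnots_adj : ∀ u, IsLeafKnot T u → G.Adj v u

/-- `G` is a triangle notch. -/
def IsTriangleNotch {V : Type*} [DecidableEq V] (G : SimpleGraph V) : Prop :=
  ∃ (m : ℕ) (T : Fin m → Finset V) (v : V), IsTriangleNotchOf G T v

/-! Compose `q` with an isometry so that it agrees with `p` on the first triangle. Unfolding the
tree, each triangle `T i` is then moved by an isometry `f i` composed of reflections in shared
edges, so `f i` is affine over any field containing the coordinates of the nodes of the edges shared
up to `T i` (`exists_rationalAffine`). The engine is genericity: an affine or quadratic identity
over a field that omits one point `p w`, once true at `p w`, is true at every point of the plane.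

Applied at the apex, this shows that `q v` is an affine image of `p v` and that all mutual distances
between neighbours of `v` are kept (`dist_eq_of_trilateration`). This covers the leaf knots. Applied
at leaf knots, it shows that all leaf triangles are moved by the same map (`eq_of_isLeafAmong`).
Peeling off triangles from the end spreads this map over the whole tree (`eq_of_eq_on_leaves`). The
map is the identity on the first triangle, so `q = p` off the apex, and three non-collinear
neighbours then fix the apex. -/

/-! ### Genericity over the field of the other points -/

/-- The field generated by the coordinates of the points other than `p w`. -/
noncomputable def fieldWithout {V : Type*} (p : V → Plane) (w : V) : IntermediateField ℚ ℝ :=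
  IntermediateField.adjoin ℚ ((fun c : V × Fin 2 => p c.1 c.2) '' {c | c.1 ≠ w})

theorem mem_fieldWithout {V : Type*} (p : V → Plane) {u w : V} (h : u ≠ w) (i : Fin 2) :
    p u i ∈ fieldWithout p w :=
  IntermediateField.subset_adjoin _ _ ⟨(u, i), h, rfl⟩

/-- The point `z` satisfies no non-trivial quadratic equation over `K`. -/
def QuadraticallyGeneric (K : IntermediateField ℚ ℝ) (z : Plane) : Prop :=
  ∀ a ∈ K, ∀ b ∈ K, ∀ c ∈ K, ∀ d ∈ K, ∀ e ∈ K, ∀ f ∈ K,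
    a * (z 0 * z 0) + b * (z 0 * z 1) + c * (z 1 * z 1) + d * z 0 + e * z 1 + f = 0 →
    a = 0 ∧ b = 0 ∧ c = 0 ∧ d = 0 ∧ e = 0 ∧ f = 0

theorem Transcendental.quadratic_coeffs_eq_zero {K : IntermediateField ℚ ℝ} {x : ℝ}
    (hx : Transcendental K x) {a b c : ℝ} (ha : a ∈ K) (hb : b ∈ K) (hc : c ∈ K)
    (h : a * (x * x) + b * x + c = 0) : a = 0 ∧ b = 0 ∧ c = 0 := by
  have hP := (transcendental_iff.1 hx)
    (Polynomial.C ⟨a, ha⟩ * Polynomial.X ^ 2 + Polynomial.C ⟨b, hb⟩ * Polynomial.X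
      + Polynomial.C ⟨c, hc⟩) (by
      simp only [map_add, map_mul, Polynomial.aeval_C, Polynomial.aeval_X, map_pow]
      rw [pow_two]
      exact h)
  have h2 := congrArg (fun P => Polynomial.coeff P 2) hP
  have h1 := congrArg (fun P => Polynomial.coeff P 1) hP
  have h0 := congrArg (fun P => Polynomial.coeff P 0) hP
  simp [Polynomial.coeff_X, Polynomial.coeff_C] at h0 h1 h2
  exact ⟨congrArg Subtype.val h2, congrArg Subtype.val h1, congrArg Subtype.val h0⟩

/-- Independence passes from ℤ to ℚ because ℚ is algebraic over ℤ, and transcendence passes from the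
algebra generated by the other coordinates to its fraction field. -/
theorem IsGenericConfig.transcendental {V : Type*} {p : V → Plane} (hp : IsGenericConfig p)
    {s : Set (V × Fin 2)} {c : V × Fin 2} (hc : c ∉ s) :
    Transcendental
      (IntermediateField.adjoin ℚ ((fun c : V × Fin 2 => p c.1 c.2) '' s)) (p c.1 c.2) := by
  have : Algebra.IsAlgebraic ℤ ℚ := IsLocalization.isAlgebraic _ (nonZeroDivisors ℤ)
  have hq : AlgebraicIndependent ℚ (fun c : V × Fin 2 => p c.1 c.2) :=
    AlgebraicIndependent.extendScalars ℚ hp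
  have ht := hq.transcendental_adjoin hc
  open scoped IntermediateField.algebraAdjoinAdjoin in
  exact ht.extendScalars _

/-- The relation is a quadratic in the second coordinate over the field `L` that also contains the
first one, so its three coefficients vanish. Each of these is a polynomial of degree at most two in
the first coordinate, and the argument repeats. -/
theorem IsGenericConfig.quadraticallyGeneric {V : Type*} {p : V → Plane}
    (hp : IsGenericConfig p) (w : V) : QuadraticallyGeneric (fieldWithout p w) (p w) := by
  intro a ha b hb c hc d hd e he f hf h
  have h0 : Transcendental (fieldWithout p w) (p w 0) :=
    hp.transcendental (s := {c | c.1 ≠ w}) (c := (w, 0)) (by simp)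
  let s : Set (V × Fin 2) := {c | c ≠ (w, 1)}
  let L := IntermediateField.adjoin ℚ ((fun c : V × Fin 2 => p c.1 c.2) '' s)
  have h1 : Transcendental L (p w 1) := hp.transcendental (s := s) (c := (w, 1)) (by simp [s])
  have hx : p w 0 ∈ L := IntermediateField.subset_adjoin _ _ ⟨(w, 0), by simp [s], rfl⟩
  have hKL : fieldWithout p w ≤ L := by
    apply IntermediateField.adjoin.mono
    apply Set.image_mono
    rintro c hc rfl
    exact hc rfl
  obtain ⟨r1, r2, r3⟩ := h1.quadratic_coeffs_eq_zero (a := c) (b := b * p w 0 + e)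
    (c := a * (p w 0 * p w 0) + d * p w 0 + f) (hKL hc)
    (add_mem (mul_mem (hKL hb) hx) (hKL he))
    (add_mem (add_mem (mul_mem (hKL ha) (mul_mem hx hx)) (mul_mem (hKL hd) hx)) (hKL hf))
    (by linear_combination h)
  obtain ⟨-, s1, s2⟩ := h0.quadratic_coeffs_eq_zero (a := 0) (zero_mem _) hb he
    (by linear_combination r2)
  obtain ⟨t1, t2, t3⟩ := h0.quadratic_coeffs_eq_zero ha hd hf r3
  exact ⟨t1, s1, r1, t2, s2, t3⟩

theorem QuadraticallyGeneric.linear_coeffs_eq_zero {K : IntermediateField ℚ ℝ} {z : Plane}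
    (hz : QuadraticallyGeneric K z) {a b c : ℝ} (ha : a ∈ K) (hb : b ∈ K) (hc : c ∈ K)
    (h : a * z 0 + b * z 1 + c = 0) : a = 0 ∧ b = 0 ∧ c = 0 :=
  (hz 0 (zero_mem _) 0 (zero_mem _) 0 (zero_mem _) a ha b hb c hc
    (by linear_combination h)).2.2.2

/-! ### Affine maps with coefficients in a subfield -/

/-- The coordinates of `z` lie in `K`. -/
def RationalPoint (K : IntermediateField ℚ ℝ) (z : Plane) : Prop := ∀ i, z i ∈ K

/-- `f` is an affine map with coefficients in `K`. -/
def RationalAffine (K : IntermediateField ℚ ℝ) (f : Plane → Plane) : Prop :=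
  ∃ (M : Fin 2 → Fin 2 → ℝ) (t : Fin 2 → ℝ), (∀ i j, M i j ∈ K) ∧ (∀ i, t i ∈ K) ∧
    ∀ z i, f z i = M i 0 * z 0 + M i 1 * z 1 + t i

namespace RationalAffine

variable {K : IntermediateField ℚ ℝ} {f g : Plane → Plane} {z c d : Plane}

theorem id : RationalAffine K id := by
  refine ⟨fun i j => if i = j then 1 else 0, fun _ => 0, fun i j => ?_, fun _ => zero_mem _,
    fun z i => ?_⟩
  · dsimp only
    split_ifs
    exacts [one_mem _, zero_mem _]
  · fin_cases i <;> simp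

theorem comp (hf : RationalAffine K f) (hg : RationalAffine K g) : RationalAffine K (f ∘ g) := by
  obtain ⟨M, t, hM, ht, h⟩ := hf
  obtain ⟨N, s, hN, hs, h'⟩ := hg
  refine ⟨fun i j => M i 0 * N 0 j + M i 1 * N 1 j, fun i => M i 0 * s 0 + M i 1 * s 1 + t i,
    fun i j => add_mem (mul_mem (hM _ _) (hN _ _)) (mul_mem (hM _ _) (hN _ _)),
    fun i => add_mem (add_mem (mul_mem (hM _ _) (hs _)) (mul_mem (hM _ _) (hs _))) (ht _),
    fun z i => ?_⟩
  rw [Function.comp_apply, h, h', h']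
  ring

theorem rationalPoint (hf : RationalAffine K f) (hz : RationalPoint K z) :
    RationalPoint K (f z) := by
  obtain ⟨M, t, hM, ht, h⟩ := hf
  intro i
  rw [h]
  exact add_mem (add_mem (mul_mem (hM _ _) (hz _)) (mul_mem (hM _ _) (hz _))) (ht _)

/-- Affine maps over `K` that agree at a generic point are equal. -/
theorem eq_of_apply_eq (hf : RationalAffine K f) (hg : RationalAffine K g)
    (hz : QuadraticallyGeneric K z) (h : f z = g z) : f = g := by
  obtain ⟨M, t, hM, ht, h1⟩ := hf
  obtain ⟨N, s, hN, hs, h2⟩ := hg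
  funext x
  ext i
  have hi : f z i = g z i := by rw [h]
  rw [h1, h2] at hi
  obtain ⟨e1, e2, e3⟩ := hz.linear_coeffs_eq_zero (sub_mem (hM i 0) (hN i 0))
    (sub_mem (hM i 1) (hN i 1)) (sub_mem (ht i) (hs i)) (by linear_combination hi)
  rw [h1, h2]
  linear_combination e1 * x 0 + e2 * x 1 + e3

end RationalAffine

theorem dist_eq_dist_iff_plane {a b c d : Plane} : dist a b = dist c d ↔
    (a 0 - b 0) ^ 2 + (a 1 - b 1) ^ 2 = (c 0 - d 0) ^ 2 + (c 1 - d 1) ^ 2 := by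
  rw [EuclideanSpace.dist_eq, EuclideanSpace.dist_eq, Real.sqrt_inj (by positivity) (by positivity)]
  simp [Fin.sum_univ_two, Real.dist_eq, sq_abs]

/-- A distance equation over `K` between affine images holds everywhere if it holds at a generic
point. -/
theorem RationalAffine.dist_eq {K : IntermediateField ℚ ℝ} {f : Plane → Plane} {z c d : Plane}
    (hf : RationalAffine K f) (hz : QuadraticallyGeneric K z)
    (hc : RationalPoint K c) (hd : RationalPoint K d) (h : dist (f z) c = dist z d) (x : Plane) :
    dist (f x) c = dist x d := by
  obtain ⟨M, t, hM, ht, h1⟩ := hf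
  rw [dist_eq_dist_iff_plane, h1, h1] at h ⊢
  have two : (2 : ℝ) ∈ K := ofNat_mem K 2
  -- These are the six coefficients of `|M z + t - c|² - |z - d|²` as a polynomial in `z`.
  obtain ⟨e1, e2, e3, e4, e5, e6⟩ := hz
    (M 0 0 * M 0 0 + M 1 0 * M 1 0 - 1)
    (sub_mem (add_mem (mul_mem (hM _ _) (hM _ _)) (mul_mem (hM _ _) (hM _ _))) (one_mem _))
    (2 * (M 0 0 * M 0 1 + M 1 0 * M 1 1))
    (mul_mem two (add_mem (mul_mem (hM _ _) (hM _ _)) (mul_mem (hM _ _) (hM _ _))))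
    (M 0 1 * M 0 1 + M 1 1 * M 1 1 - 1)
    (sub_mem (add_mem (mul_mem (hM _ _) (hM _ _)) (mul_mem (hM _ _) (hM _ _))) (one_mem _))
    (2 * (M 0 0 * (t 0 - c 0) + M 1 0 * (t 1 - c 1) + d 0))
    (mul_mem two (add_mem (add_mem (mul_mem (hM _ _) (sub_mem (ht _) (hc _)))
      (mul_mem (hM _ _) (sub_mem (ht _) (hc _)))) (hd _)))
    (2 * (M 0 1 * (t 0 - c 0) + M 1 1 * (t 1 - c 1) + d 1))
    (mul_mem two (add_mem (add_mem (mul_mem (hM _ _) (sub_mem (ht _) (hc _)))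
      (mul_mem (hM _ _) (sub_mem (ht _) (hc _)))) (hd _)))
    ((t 0 - c 0) * (t 0 - c 0) + (t 1 - c 1) * (t 1 - c 1) - d 0 * d 0 - d 1 * d 1)
    (sub_mem (sub_mem (add_mem (mul_mem (sub_mem (ht _) (hc _)) (sub_mem (ht _) (hc _)))
      (mul_mem (sub_mem (ht _) (hc _)) (sub_mem (ht _) (hc _)))) (mul_mem (hd _) (hd _)))
      (mul_mem (hd _) (hd _)))
    (by linear_combination h)
  linear_combination e1 * (x 0 * x 0) + e2 * (x 0 * x 1) + e3 * (x 1 * x 1) + e4 * x 0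
    + e5 * x 1 + e6

/-! ### Areas, reflections and isometries of the plane -/

/-- Twice the signed area of a triangle. -/
def signedArea (a b c : Plane) : ℝ :=
  (b 0 - a 0) * (c 1 - a 1) - (b 1 - a 1) * (c 0 - a 0)

theorem IsGenericConfig.injective {V : Type*} {p : V → Plane} (hp : IsGenericConfig p)
    {u w : V} (h : u ≠ w) : p u ≠ p w := by
  intro he
  have := (hp.quadraticallyGeneric u).linear_coeffs_eq_zero (a := 1) (b := 0) (c := - p w 0)
    (one_mem _) (zero_mem _) (neg_mem (mem_fieldWithout p h.symm 0)) (by rw [he]; ring)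
  exact one_ne_zero this.1

theorem IsGenericConfig.signedArea_ne_zero {V : Type*} {p : V → Plane} (hp : IsGenericConfig p)
    {a b c : V} (hab : a ≠ b) (hac : a ≠ c) (hbc : b ≠ c) :
    signedArea (p a) (p b) (p c) ≠ 0 := by
  intro he
  have hb := mem_fieldWithout p hab.symm
  have hc := mem_fieldWithout p hac.symm
  obtain ⟨h0, h1, -⟩ := (hp.quadraticallyGeneric a).linear_coeffs_eq_zero
    (sub_mem (hb 1) (hc 1)) (sub_mem (hc 0) (hb 0))
    (sub_mem (mul_mem (hb 0) (hc 1)) (mul_mem (hb 1) (hc 0)))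
    (by unfold signedArea at he; linear_combination he)
  apply hp.injective hbc
  ext i
  fin_cases i
  · simpa using (sub_eq_zero.1 h1).symm
  · simpa using sub_eq_zero.1 h0

/-- Reflection of the plane in the line through `a` and `b`. -/
noncomputable def lineReflection (a b z : Plane) : Plane :=
  let k := 2 * ((z 0 - a 0) * (b 0 - a 0) + (z 1 - a 1) * (b 1 - a 1)) /
    ((b 0 - a 0) ^ 2 + (b 1 - a 1) ^ 2)
  !₂[2 * a 0 - z 0 + k * (b 0 - a 0), 2 * a 1 - z 1 + k * (b 1 - a 1)]

theorem sq_add_sq_ne_zero_of_ne {a b : Plane} (h : a ≠ b) :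
    (b 0 - a 0) ^ 2 + (b 1 - a 1) ^ 2 ≠ 0 := by
  intro he
  apply h
  have h0 : b 0 - a 0 = 0 := by nlinarith [sq_nonneg (b 0 - a 0), sq_nonneg (b 1 - a 1)]
  have h1 : b 1 - a 1 = 0 := by nlinarith [sq_nonneg (b 0 - a 0), sq_nonneg (b 1 - a 1)]
  ext i
  fin_cases i
  · exact (sub_eq_zero.1 h0).symm
  · exact (sub_eq_zero.1 h1).symm

theorem lineReflection_isometry {a b : Plane} (h : a ≠ b) : Isometry (lineReflection a b) := by
  refine Isometry.of_dist_eq fun x y => ?_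
  have hne := sq_add_sq_ne_zero_of_ne h
  rw [dist_eq_dist_iff_plane]
  simp only [lineReflection, PiLp.toLp_apply, Matrix.cons_val_zero, Matrix.cons_val_one]
  field_simp
  ring

theorem lineReflection_left (a b : Plane) : lineReflection a b a = a := by
  ext i
  fin_cases i <;> simp [lineReflection] <;> ring

theorem lineReflection_right {a b : Plane} (h : a ≠ b) : lineReflection a b b = b := by
  have hne := sq_add_sq_ne_zero_of_ne h
  have hk : 2 * ((b 0 - a 0) * (b 0 - a 0) + (b 1 - a 1) * (b 1 - a 1)) /
      ((b 0 - a 0) ^ 2 + (b 1 - a 1) ^ 2) = 2 := by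
    field_simp
  ext i
  fin_cases i <;> simp only [lineReflection, hk] <;> simp <;> ring

theorem lineReflection_ne {a b c : Plane} (h : a ≠ b) (hc : signedArea a b c ≠ 0) :
    c ≠ lineReflection a b c := by
  intro he
  apply hc
  have hne := sq_add_sq_ne_zero_of_ne h
  have h0 := congrArg (fun z : Plane => z 0) he
  have h1 := congrArg (fun z : Plane => z 1) he
  simp only [lineReflection, Matrix.cons_val_zero, Matrix.cons_val_one] at h0 h1
  unfold signedArea
  linear_combination (b 0 - a 0) * h1 / 2 - (b 1 - a 1) * h0 / 2

theorem lineReflection_rationalAffine {K : IntermediateField ℚ ℝ} {a b : Plane}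
    (ha : RationalPoint K a) (hb : RationalPoint K b) :
    RationalAffine K (lineReflection a b) := by
  have hd : ∀ i, b i - a i ∈ K := fun i => sub_mem (hb i) (ha i)
  have hn : 2 / ((b 0 - a 0) ^ 2 + (b 1 - a 1) ^ 2) ∈ K :=
    div_mem (ofNat_mem K 2) (add_mem (pow_mem (hd 0) 2) (pow_mem (hd 1) 2))
  refine ⟨fun i j => (2 / ((b 0 - a 0) ^ 2 + (b 1 - a 1) ^ 2)) * ((b i - a i) * (b j - a j))
      - if i = j then 1 else 0,
    fun i => 2 * a i - (2 / ((b 0 - a 0) ^ 2 + (b 1 - a 1) ^ 2)) *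
      (a 0 * (b 0 - a 0) + a 1 * (b 1 - a 1)) * (b i - a i), fun i j => ?_, fun i => ?_,
    fun z i => ?_⟩
  · refine sub_mem (mul_mem hn (mul_mem (hd _) (hd _))) ?_
    split_ifs
    exacts [one_mem _, zero_mem _]
  · exact sub_mem (mul_mem (ofNat_mem K 2) (ha i))
      (mul_mem (mul_mem hn (add_mem (mul_mem (ha 0) (hd 0)) (mul_mem (ha 1) (hd 1)))) (hd i))
  · fin_cases i <;> simp [lineReflection] <;> ring

/-- The circles about `f a` and `f b` meet in at most two points, and the two images named are
distinct common points because `c` is off the line `ab`. -/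
theorem eq_or_eq_lineReflection {f : Plane → Plane} (hf : Isometry f) {a b c y : Plane}
    (hc : signedArea a b c ≠ 0) (ha : dist y (f a) = dist c a) (hb : dist y (f b) = dist c b) :
    y = f c ∨ y = f (lineReflection a b c) := by
  have hab : a ≠ b := by
    rintro rfl
    exact hc (by simp [signedArea])
  have hr := lineReflection_isometry hab
  refine EuclideanGeometry.eq_of_dist_eq_of_dist_eq_of_finrank_eq_two (by simp)
    (hf.injective.ne hab) (hf.injective.ne (lineReflection_ne hab hc)) (hf.dist_eq c a) ?_ ha
    (hf.dist_eq c b) ?_ hb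
  · rw [hf.dist_eq, ← hr.dist_eq c a, lineReflection_left]
  · rw [hf.dist_eq, ← hr.dist_eq c b, lineReflection_right hab]

/-- Two congruent pairs of points can be matched by an isometry of the plane. -/
theorem exists_isometry_of_dist_eq {a b a' b' : Plane} (h : a ≠ b) (hd : dist a' b' = dist a b) :
    ∃ f : Plane → Plane, Isometry f ∧ f a = a' ∧ f b = b' := by
  have hne := sq_add_sq_ne_zero_of_ne h
  have hd' : (b' 0 - a' 0) ^ 2 + (b' 1 - a' 1) ^ 2 = (b 0 - a 0) ^ 2 + (b 1 - a 1) ^ 2 := by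
    have := dist_eq_dist_iff_plane.1 hd
    linear_combination this
  set n := (b 0 - a 0) ^ 2 + (b 1 - a 1) ^ 2 with hn
  -- `C` and `S` are the cosine and sine of the angle from `b - a` to `b' - a'`; the isometry is
  -- this rotation followed by a translation.
  set C := ((b 0 - a 0) * (b' 0 - a' 0) + (b 1 - a 1) * (b' 1 - a' 1)) / n with hC
  set S := ((b 0 - a 0) * (b' 1 - a' 1) - (b 1 - a 1) * (b' 0 - a' 0)) / n with hS
  have hCn : C * n = (b 0 - a 0) * (b' 0 - a' 0) + (b 1 - a 1) * (b' 1 - a' 1) := by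
    rw [hC, div_mul_cancel₀ _ hne]
  have hSn : S * n = (b 0 - a 0) * (b' 1 - a' 1) - (b 1 - a 1) * (b' 0 - a' 0) := by
    rw [hS, div_mul_cancel₀ _ hne]
  have hCS : C ^ 2 + S ^ 2 = 1 := by
    apply mul_right_cancel₀ (pow_ne_zero 2 hne)
    have : (C * n) ^ 2 + (S * n) ^ 2 = n * n := by
      rw [hCn, hSn]
      nth_rewrite 2 [← hd']
      rw [hn]
      ring
    linear_combination this
  refine ⟨fun z => !₂[a' 0 + C * (z 0 - a 0) - S * (z 1 - a 1),
    a' 1 + S * (z 0 - a 0) + C * (z 1 - a 1)], ?_, ?_, ?_⟩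
  · refine Isometry.of_dist_eq fun x y => ?_
    rw [dist_eq_dist_iff_plane]
    simp only [Matrix.cons_val_zero, Matrix.cons_val_one]
    linear_combination hCS * ((x 0 - y 0) ^ 2 + (x 1 - y 1) ^ 2)
  · ext i
    fin_cases i <;> simp
  · ext i
    fin_cases i
    · simp
      apply mul_right_cancel₀ hne
      rw [hn] at hCn hSn ⊢
      linear_combination (b 0 - a 0) * hCn - (b 1 - a 1) * hSn
    · simp
      apply mul_right_cancel₀ hne
      rw [hn] at hCn hSn ⊢
      linear_combination (b 0 - a 0) * hSn + (b 1 - a 1) * hCn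

/-- Two congruent triangles can be matched by an isometry of the plane. -/
theorem exists_isometry_of_triangle {a b c a' b' c' : Plane} (h : signedArea a b c ≠ 0)
    (hab : dist a' b' = dist a b) (hca : dist c' a' = dist c a) (hcb : dist c' b' = dist c b) :
    ∃ f : Plane → Plane, Isometry f ∧ f a = a' ∧ f b = b' ∧ f c = c' := by
  have hne : a ≠ b := by
    rintro rfl
    exact h (by simp [signedArea])
  obtain ⟨f, hf, rfl, rfl⟩ := exists_isometry_of_dist_eq hne hab
  rcases eq_or_eq_lineReflection hf h hca hcb with rfl | rfl
  · exact ⟨f, hf, rfl, rfl, rfl⟩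
  · refine ⟨f ∘ lineReflection a b, hf.comp (lineReflection_isometry hne), ?_, ?_, rfl⟩
    · rw [Function.comp_apply, lineReflection_left]
    · rw [Function.comp_apply, lineReflection_right hne]

/-- Heron's formula: the squared area is a polynomial in the squared side lengths. It transfers
non-degeneracy from a triangle to any congruent one. -/
theorem signedArea_sq_eq {a b c a' b' c' : Plane} (hab : dist a' b' = dist a b)
    (hca : dist c' a' = dist c a) (hcb : dist c' b' = dist c b) :
    signedArea a' b' c' ^ 2 = signedArea a b c ^ 2 := by
  rw [dist_eq_dist_iff_plane] at hab hca hcb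
  have key : ∀ a b c : Plane, signedArea a b c ^ 2 =
      ((a 0 - b 0) ^ 2 + (a 1 - b 1) ^ 2) * ((c 0 - a 0) ^ 2 + (c 1 - a 1) ^ 2) -
      (((a 0 - b 0) ^ 2 + (a 1 - b 1) ^ 2 + ((c 0 - a 0) ^ 2 + (c 1 - a 1) ^ 2) -
        ((c 0 - b 0) ^ 2 + (c 1 - b 1) ^ 2)) / 2) ^ 2 := by
    intro a b c
    unfold signedArea
    ring
  rw [key, key, hab, hca, hcb]

/-- A point is determined by its distances to the vertices of a triangle. -/
theorem eq_of_dist_eq_of_signedArea_ne_zero {a b c x y : Plane} (h : signedArea a b c ≠ 0)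
    (ha : dist y a = dist x a) (hb : dist y b = dist x b) (hc : dist y c = dist x c) : y = x := by
  rw [dist_eq_dist_iff_plane] at ha hb hc
  unfold signedArea at h
  ext i
  apply mul_left_cancel₀ h
  fin_cases i
  · simp only [Fin.zero_eta]
    -- The three multipliers sum to zero, which cancels the quadratic terms; the rest is Cramer's
    -- rule.
    linear_combination (c 1 - b 1) * ha / 2 + (a 1 - c 1) * hb / 2 + (b 1 - a 1) * hc / 2
  · simp only [Fin.mk_one]
    linear_combination (b 0 - c 0) * ha / 2 + (c 0 - a 0) * hb / 2 + (a 0 - b 0) * hc / 2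

/-! ### Trilateration from a generic point -/

/-- If the distances from a generic point to at least three points that are not collinear equal
the distances from some point to corresponding points, all over the same field, then
corresponding points have the same mutual distances. -/
theorem QuadraticallyGeneric.dist_eq_of_trilateration {K : IntermediateField ℚ ℝ} {x y : Plane}
    (hx : QuadraticallyGeneric K x) {ι : Type*} {P Q : ι → Plane}
    (hP : ∀ i, RationalPoint K (P i)) (hQ : ∀ i, RationalPoint K (Q i)) {a b c : ι}
    (habc : signedArea (P a) (P b) (P c) ≠ 0) (hd : ∀ i, dist y (Q i) = dist x (P i)) (i j : ι) :
    dist (Q i) (Q j) = dist (P i) (P j) := by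
  have two : (2 : ℝ) ∈ K := ofNat_mem K 2
  have hs := fun i => dist_eq_dist_iff_plane.1 (hd i)
  -- the terms of the equation for `i` minus the equation for `a`
  let r : ι → ℝ := fun i => (Q i 0 * Q i 0 + Q i 1 * Q i 1 - Q a 0 * Q a 0 - Q a 1 * Q a 1 -
    (P i 0 * P i 0 + P i 1 * P i 1 - P a 0 * P a 0 - P a 1 * P a 1)) / 2
  have hr : ∀ i, r i ∈ K := fun i =>
    have hm : ∀ {s t : ℝ}, s ∈ K → t ∈ K → s * t ∈ K := mul_mem
    div_mem (sub_mem (sub_mem (sub_mem (add_mem (hm (hQ i 0) (hQ i 0)) (hm (hQ i 1) (hQ i 1)))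
      (hm (hQ a 0) (hQ a 0))) (hm (hQ a 1) (hQ a 1))) (sub_mem (sub_mem (add_mem
      (hm (hP i 0) (hP i 0)) (hm (hP i 1) (hP i 1))) (hm (hP a 0) (hP a 0)))
      (hm (hP a 1) (hP a 1)))) two
  -- Subtracting the equation for `a` removes the squares of the unknown coordinates.
  have hl : ∀ i, (Q i 0 - Q a 0) * y 0 + (Q i 1 - Q a 1) * y 1 =
      (P i 0 - P a 0) * x 0 + (P i 1 - P a 1) * x 1 + r i := by
    intro i
    simp only [r]
    linear_combination (hs a - hs i) / 2
  have hPd : ∀ i k, P i k - P a k ∈ K := fun i k => sub_mem (hP i k) (hP a k)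
  have hQd : ∀ i k, Q i k - Q a k ∈ K := fun i k => sub_mem (hQ i k) (hQ a k)
  by_cases hD : signedArea (Q a) (Q b) (Q c) = 0
  · exfalso
    -- By `hl`, a relation over `K` between `Q b - Q a` and `Q c - Q a` becomes a linear relation
    -- for the generic point `x`, hence one between the independent vectors `P b - P a` and `P c - P
    -- a`.
    have hrel : ∀ s ∈ K, ∀ t ∈ K,
        s * (Q b 0 - Q a 0) + t * (Q c 0 - Q a 0) = 0 →
        s * (Q b 1 - Q a 1) + t * (Q c 1 - Q a 1) = 0 → s = 0 ∧ t = 0 := by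
      intro s hs t ht h0 h1
      obtain ⟨e0, e1, -⟩ := hx.linear_coeffs_eq_zero
        (add_mem (mul_mem hs (hPd b 0)) (mul_mem ht (hPd c 0)))
        (add_mem (mul_mem hs (hPd b 1)) (mul_mem ht (hPd c 1)))
        (add_mem (mul_mem hs (hr b)) (mul_mem ht (hr c)))
        (by linear_combination h0 * y 0 + h1 * y 1 - s * hl b - t * hl c)
      unfold signedArea at habc
      constructor
      · apply mul_right_cancel₀ habc
        linear_combination (P c 1 - P a 1) * e0 - (P c 0 - P a 0) * e1
      · apply mul_right_cancel₀ habc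
        linear_combination (P b 0 - P a 0) * e1 - (P b 1 - P a 1) * e0
    unfold signedArea at hD
    -- The vanishing determinant supplies relations whose coefficients are the coordinates
    -- themselves. So these vanish, and then `1, 0` is a relation too.
    obtain ⟨h1, h2⟩ := hrel (Q c 0 - Q a 0) (hQd c 0) (-(Q b 0 - Q a 0)) (neg_mem (hQd b 0))
      (by ring) (by linear_combination -hD)
    obtain ⟨h3, h4⟩ := hrel (Q c 1 - Q a 1) (hQd c 1) (-(Q b 1 - Q a 1)) (neg_mem (hQd b 1))
      (by linear_combination hD) (by ring)
    exact one_ne_zero (hrel 1 (one_mem _) 0 (zero_mem _) (by linear_combination -h2)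
      (by linear_combination -h4)).1
  · -- by Cramer's rule `y` is an affine image of `x`
    set D := signedArea (Q a) (Q b) (Q c) with hDdef
    have hDK : D ∈ K := sub_mem (mul_mem (hQd b 0) (hQd c 1)) (mul_mem (hQd b 1) (hQd c 0))
    let A : Plane → Plane := fun z =>
      !₂[((Q c 1 - Q a 1) * ((P b 0 - P a 0) * z 0 + (P b 1 - P a 1) * z 1 + r b) -
          (Q b 1 - Q a 1) * ((P c 0 - P a 0) * z 0 + (P c 1 - P a 1) * z 1 + r c)) / D,
        ((Q b 0 - Q a 0) * ((P c 0 - P a 0) * z 0 + (P c 1 - P a 1) * z 1 + r c) -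
          (Q c 0 - Q a 0) * ((P b 0 - P a 0) * z 0 + (P b 1 - P a 1) * z 1 + r b)) / D]
    have hA : RationalAffine K A := by
      refine ⟨fun i k => if i = 0 then
          ((Q c 1 - Q a 1) * (P b k - P a k) - (Q b 1 - Q a 1) * (P c k - P a k)) / D
        else ((Q b 0 - Q a 0) * (P c k - P a k) - (Q c 0 - Q a 0) * (P b k - P a k)) / D,
        fun i => if i = 0 then ((Q c 1 - Q a 1) * r b - (Q b 1 - Q a 1) * r c) / D
        else ((Q b 0 - Q a 0) * r c - (Q c 0 - Q a 0) * r b) / D, fun i k => ?_, fun i => ?_,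
        fun z i => ?_⟩
      · dsimp only
        split_ifs
        · exact div_mem (sub_mem (mul_mem (hQd _ _) (hPd _ _)) (mul_mem (hQd _ _) (hPd _ _))) hDK
        · exact div_mem (sub_mem (mul_mem (hQd _ _) (hPd _ _)) (mul_mem (hQd _ _) (hPd _ _))) hDK
      · dsimp only
        split_ifs
        · exact div_mem (sub_mem (mul_mem (hQd _ _) (hr _)) (mul_mem (hQd _ _) (hr _))) hDK
        · exact div_mem (sub_mem (mul_mem (hQd _ _) (hr _)) (mul_mem (hQd _ _) (hr _))) hDK
      · fin_cases i <;> simp [A] <;> ring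
    have hAx : A x = y := by
      have hb := hl b
      have hc := hl c
      have hD' : D = (Q b 0 - Q a 0) * (Q c 1 - Q a 1) - (Q b 1 - Q a 1) * (Q c 0 - Q a 0) := rfl
      ext i
      fin_cases i
      · simp only [A, Fin.zero_eta, Matrix.cons_val_zero]
        rw [div_eq_iff hD, hD']
        linear_combination (Q b 1 - Q a 1) * hc - (Q c 1 - Q a 1) * hb
      · simp only [A, Fin.mk_one, Matrix.cons_val_one, Matrix.cons_val_zero]
        rw [div_eq_iff hD, hD']
        linear_combination (Q c 0 - Q a 0) * hb - (Q b 0 - Q a 0) * hc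
    have hAd : ∀ i z, dist (A z) (Q i) = dist z (P i) := fun i z =>
      hA.dist_eq hx (hQ i) (hP i) (by rw [hAx]; exact hd i) z
    -- The identity at `z = P i` is read first against `Q i` and then against `Q j`.
    have hAP : A (P i) = Q i := by
      rw [← dist_eq_zero, hAd, dist_self]
    rw [← hAP, hAd]

/-! ### Leaves and shared edges of triangle trees -/

theorem SharesEdge.symm {V : Type*} [DecidableEq V] {S T : Finset V} (h : SharesEdge S T) :
    SharesEdge T S := by
  rwa [SharesEdge, Finset.inter_comm]

/-- Among the first `n` triangles, `T k` shares an edge with exactly one other triangle. -/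
def IsLeafAmong {V : Type*} [DecidableEq V] {m : ℕ} (T : Fin m → Finset V) (n : ℕ) (k : Fin m) :
    Prop :=
  k.val < n ∧ ∃! j : Fin m, j.val < n ∧ j ≠ k ∧ SharesEdge (T j) (T k)

namespace IsTriangleTree

variable {V : Type*} [DecidableEq V] {m : ℕ} {T : Fin m → Finset V}

/-- The triangle `T i` consists of an edge of an earlier triangle and of a new node. -/
theorem exists_eq_insert (hT : IsTriangleTree T) {i j : Fin m} (hji : j < i)
    (h : SharesEdge (T j) (T i)) : ∃ a b d, a ≠ b ∧ a ≠ d ∧ b ≠ d ∧ a ∈ T j ∧ b ∈ T j ∧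
      T j ∩ T i = {a, b} ∧ T i = {a, b, d} ∧ ∀ k < i, d ∉ T k := by
  obtain ⟨a, b, hab, he⟩ := Finset.card_eq_two.1 h
  have hcard : (T i \ (T j ∩ T i)).card = 1 := by
    rw [Finset.card_sdiff_of_subset Finset.inter_subset_right, hT.card_eq_three, h]
  obtain ⟨d, hd⟩ := Finset.card_eq_one.1 hcard
  have hmem : ∀ x, x ∈ ({a, b} : Finset V) ↔ x ∈ T j ∧ x ∈ T i := fun x => by
    rw [← he, Finset.mem_inter]
  have hd' : ∀ x, x = d ↔ x ∈ T i ∧ ¬(x ∈ T j ∧ x ∈ T i) := fun x => by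
    rw [← Finset.mem_singleton, ← hd, Finset.mem_sdiff, Finset.mem_inter]
  have ha := (hmem a).1 (by simp)
  have hb := (hmem b).1 (by simp)
  have hdd := (hd' d).1 rfl
  refine ⟨a, b, d, hab, ?_, ?_, ha.1, hb.1, he, ?_, ?_⟩
  · rintro rfl; exact hdd.2 ha
  · rintro rfl; exact hdd.2 hb
  · ext x
    have h1 := hmem x
    have h2 := hd' x
    simp only [Finset.mem_insert, Finset.mem_singleton] at h1 ⊢
    tauto
  · exact hT.new_node i j hji h d hdd.1 fun h' => hdd.2 ⟨h', hdd.1⟩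

theorem exists_parent (hT : IsTriangleTree T) {i : Fin m} (hi : 0 < i.val) :
    ∃ j < i, SharesEdge (T j) (T i) :=
  (hT.attached i hi).exists

theorem parent_unique (hT : IsTriangleTree T) {i j k : Fin m} (hj : j < i)
    (hji : SharesEdge (T j) (T i)) (hk : k < i) (hki : SharesEdge (T k) (T i)) : j = k :=
  (hT.attached i (by have : j.val < i.val := hj; omega)).unique ⟨hj, hji⟩ ⟨hk, hki⟩

/-- A node of `T i` that lies in an earlier triangle lies in the triangle `T i` is attached to. -/
theorem mem_parent (hT : IsTriangleTree T) {i j k : Fin m} (hj : j < i)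
    (hji : SharesEdge (T j) (T i)) (hk : k < i) {u : V} (hui : u ∈ T i) (huk : u ∈ T k) :
    u ∈ T j := by
  by_contra h
  exact hT.new_node i j hj hji u hui h k hk huk

/-- The last triangle is a leaf. -/
theorem isLeafAmong_last (hT : IsTriangleTree T) {i : Fin m} (hi : 0 < i.val) :
    IsLeafAmong T (i.val + 1) i := by
  obtain ⟨j, hj, hji⟩ := hT.exists_parent hi
  refine ⟨Nat.lt_succ_self _, j, ⟨Nat.lt_succ_of_lt hj, hj.ne, hji⟩, ?_⟩
  rintro k ⟨hk, hki, hs⟩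
  exact hT.parent_unique (lt_of_le_of_ne (Nat.le_of_lt_succ hk) hki) hs hj hji

/-- A leaf stays a leaf when a triangle is attached to another triangle. -/
theorem isLeafAmong_succ (hT : IsTriangleTree T) {i j k : Fin m} (hj : j < i)
    (hji : SharesEdge (T j) (T i)) (hk : IsLeafAmong T i.val k) (hkj : k ≠ j) :
    IsLeafAmong T (i.val + 1) k := by
  obtain ⟨hki, l, ⟨hl1, hl2, hl3⟩, hu⟩ := hk
  refine ⟨Nat.lt_succ_of_lt hki, l, ⟨Nat.lt_succ_of_lt hl1, hl2, hl3⟩, ?_⟩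
  rintro l' ⟨h1, h2, h3⟩
  rcases Nat.lt_succ_iff_lt_or_eq.1 h1 with h | h
  · exact hu l' ⟨h, h2, h3⟩
  · obtain rfl : l' = i := Fin.ext h
    exact absurd (hT.parent_unique hki h3.symm hj hji) hkj

/-- There are at least two leaves. -/
theorem exists_isLeafAmong_ne (hT : IsTriangleTree T) (n : ℕ) (hn : 2 ≤ n) :
    n ≤ m → ∀ j : Fin m, ∃ k, k ≠ j ∧ IsLeafAmong T n k := by
  induction n, hn using Nat.le_induction with
  | base =>
    intro hm j
    have h1 : IsLeafAmong T 2 ⟨1, by omega⟩ :=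
      hT.isLeafAmong_last (i := ⟨1, by omega⟩) Nat.one_pos
    by_cases hj : j = ⟨1, by omega⟩
    · subst hj
      obtain ⟨l, hl, hs⟩ := hT.exists_parent (i := ⟨1, by omega⟩) Nat.one_pos
      have hl0 : l = ⟨0, by omega⟩ := Fin.ext (by have : l.val < 1 := hl; simp; omega)
      rw [hl0] at hs
      refine ⟨⟨0, by omega⟩, by simp, by simp, ⟨1, by omega⟩, ⟨by simp, by simp, hs.symm⟩, ?_⟩
      rintro k ⟨hk, hk0, -⟩
      have : k.val ≠ 0 := fun h => hk0 (Fin.ext h)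
      exact Fin.ext (by simp; omega)
    · exact ⟨_, Ne.symm hj, h1⟩
  | succ n hn ih =>
    intro hm j
    let i : Fin m := ⟨n, by omega⟩
    -- The last triangle is itself a leaf; if it is the one to avoid, an old leaf other than its
    -- parent remains a leaf.
    by_cases hj : j = i
    · subst hj
      obtain ⟨l, hl, hs⟩ := hT.exists_parent (i := i) (by simp only [i]; omega)
      obtain ⟨k, hkl, hk⟩ := ih (by omega) l
      exact ⟨k, fun h => by have := hk.1; rw [h] at this; exact lt_irrefl _ this,
        hT.isLeafAmong_succ hl hs hk hkl⟩
    · exact ⟨i, Ne.symm hj, hT.isLeafAmong_last (by simp only [i]; omega)⟩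

/-- The node of a leaf opposite to its shared edge lies in no other triangle. -/
theorem notMem_of_leaf (hT : IsTriangleTree T) {n : ℕ} {j l : Fin m} (hjn : j.val < n)
    (hu : ∀ k : Fin m, k.val < n → k ≠ j → SharesEdge (T k) (T j) → k = l) {w : V}
    (hwj : w ∈ T j) (hwl : w ∉ T l) (k : Fin m) (hkn : k.val < n) (hkj : k ≠ j) : w ∉ T k := by
  -- If `k < j`, the node `w` passes to the parent of `T j`, which is `T l`. If `k > j`, it passes
  -- to the parent of `T k`: either this is `T j`, and then `k = l`, or it is an earlier triangle
  -- containing `w`.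
  induction hv : k.val using Nat.strong_induction_on generalizing k with
  | _ v ih =>
    intro hwk
    rcases lt_or_gt_of_ne hkj with h | h
    · obtain ⟨i, hi, hs⟩ := hT.exists_parent (i := j) (lt_of_le_of_lt (Nat.zero_le _) h)
      have hwi := hT.mem_parent hi hs h hwj hwk
      rw [hu i (lt_trans hi hjn) hi.ne hs] at hwi
      exact hwl hwi
    · obtain ⟨i, hi, hs⟩ := hT.exists_parent (i := k) (lt_of_le_of_lt (Nat.zero_le _) h)
      have hwi := hT.mem_parent hi hs h hwk hwj
      by_cases hij : i = j
      · subst hij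
        rw [hu k hkn hkj hs.symm] at hwk
        exact hwl hwk
      · exact ih i.val (hv ▸ hi) i (lt_trans hi hkn) hij rfl hwi

theorem exists_mem_notMem (hT : IsTriangleTree T) {j l : Fin m} (h : SharesEdge (T l) (T j)) :
    ∃ w ∈ T j, w ∉ T l := by
  by_contra! hc
  have : T l ∩ T j = T j := Finset.inter_eq_right.2 hc
  rw [SharesEdge, this, hT.card_eq_three] at h
  omega

/-- The node of `T j` opposite to the edge shared with `T l` lies on any further edge that `T j`
shares with a later triangle. -/
theorem mem_of_sharesEdge (hT : IsTriangleTree T) {i j l : Fin m} (hj : j < i) (hl : l < i)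
    (hlj : l ≠ j) (hs : SharesEdge (T l) (T j)) (hji : SharesEdge (T j) (T i)) {w : V}
    (hwj : w ∈ T j) (hwl : w ∉ T l) : w ∈ T i := by
  by_contra hwi
  -- Without `w`, both edges would be the remaining pair of nodes of `T j`. Then `T i` would share
  -- an edge with `T l` as well and have two parents.
  have hsub : T j ∩ T i ⊆ T l ∩ T j := by
    apply (Finset.eq_of_subset_of_card_le (t := (T j).erase w) _ _).trans_subset
    · refine (Finset.eq_of_subset_of_card_le (s := T l ∩ T j) ?_ ?_).symm.subset
      · intro x hx
        rw [Finset.mem_inter] at hx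
        exact Finset.mem_erase.2 ⟨fun h => hwl (h ▸ hx.1), hx.2⟩
      · rw [Finset.card_erase_of_mem hwj, hT.card_eq_three, hs]
    · intro x hx
      rw [Finset.mem_inter] at hx
      exact Finset.mem_erase.2 ⟨fun h => hwi (h ▸ hx.2), hx.1⟩
    · rw [Finset.card_erase_of_mem hwj, hT.card_eq_three, hji]
  obtain ⟨a, b, d, hab, had, hbd, haj, hbj, he, hTi, hd⟩ := hT.exists_eq_insert hj hji
  have hab' : ∀ x ∈ ({a, b} : Finset V), x ∈ T l := fun x hx =>
    (Finset.mem_inter.1 (hsub (he ▸ hx))).1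
  have hli : SharesEdge (T l) (T i) := by
    have : T l ∩ T i = {a, b} := by
      ext x
      rw [hTi]
      have h1 := hab' x
      have h2 := hd l hl
      simp only [Finset.mem_inter, Finset.mem_insert, Finset.mem_singleton] at h1 ⊢
      constructor
      · rintro ⟨hx, h | h | rfl⟩
        exacts [Or.inl h, Or.inr h, absurd hx h2]
      · intro h
        exact ⟨h1 h, by tauto⟩
    rw [SharesEdge, this, Finset.card_pair hab]
  exact hlj (hT.parent_unique hl hli hj hji)

/-! ### The maps that move the triangles -/

variable {p q : V → Plane}

/-- A placement with the same edge lengths that fixes the first triangle arises from the generic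
one by maps that are composed of reflections in shared edges. -/
theorem exists_rationalAffine (hT : IsTriangleTree T) (hp : IsGenericConfig p)
    (hq : ∀ i, ∀ u ∈ T i, ∀ w ∈ T i, dist (q u) (q w) = dist (p u) (p w))
    (h0 : ∀ i : Fin m, i.val = 0 → ∀ u ∈ T i, q u = p u) (i : Fin m) :
    ∃ f : Plane → Plane, Isometry f ∧ (∀ u ∈ T i, f (p u) = q u) ∧
      ∀ K : IntermediateField ℚ ℝ,
        (∀ j k : Fin m, k ≤ i → j < k → SharesEdge (T j) (T k) → ∀ u ∈ T j, u ∈ T k →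
          RationalPoint K (p u)) → RationalAffine K f := by
  -- The map is chosen before the field, so it can later be tested over several fields. Only edges
  -- shared up to `T i` constrain `K`, so a node lying in just one triangle of an initial segment
  -- can be omitted even if later triangles contain it.
  induction hv : i.val using Nat.strong_induction_on generalizing i with
  | _ v ih =>
    rcases Nat.eq_zero_or_pos i.val with hi | hi
    · exact ⟨id, isometry_id, fun u hu => (h0 i hi u hu).symm, fun K _ => RationalAffine.id⟩
    · obtain ⟨j, hj, hs⟩ := hT.exists_parent hi
      obtain ⟨f, hf, hfq, hfK⟩ := ih j.val (hv ▸ hj) j rfl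
      obtain ⟨a, b, d, hab, had, hbd, haj, hbj, he, hTi, hd⟩ := hT.exists_eq_insert hj hs
      have ha : a ∈ T i := by simp [hTi]
      have hb : b ∈ T i := by simp [hTi]
      have hdi : d ∈ T i := by simp [hTi]
      have hfK' : ∀ K : IntermediateField ℚ ℝ,
          (∀ j k : Fin m, k ≤ i → j < k → SharesEdge (T j) (T k) → ∀ u ∈ T j, u ∈ T k →
            RationalPoint K (p u)) → RationalAffine K f := fun K hK =>
        hfK K fun j' k hk => hK j' k (hk.trans hj.le)
      have key := eq_or_eq_lineReflection hf (y := q d) (hp.signedArea_ne_zero hab had hbd)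
        (by rw [hfq a haj]; exact hq i d hdi a ha) (by rw [hfq b hbj]; exact hq i d hdi b hb)
      rcases key with h | h
      · refine ⟨f, hf, fun u hu => ?_, hfK'⟩
        simp only [hTi, Finset.mem_insert, Finset.mem_singleton] at hu
        rcases hu with rfl | rfl | rfl
        exacts [hfq _ haj, hfq _ hbj, h.symm]
      · have hne := hp.injective hab
        refine ⟨f ∘ lineReflection (p a) (p b), hf.comp (lineReflection_isometry hne),
          fun u hu => ?_, fun K hK => (hfK' K hK).comp (lineReflection_rationalAffine
            (hK j i le_rfl hj hs a haj ha) (hK j i le_rfl hj hs b hbj hb))⟩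
        simp only [hTi, Finset.mem_insert, Finset.mem_singleton] at hu
        rw [Function.comp_apply]
        rcases hu with rfl | rfl | rfl
        · rw [lineReflection_left, hfq _ haj]
        · rw [lineReflection_right hne, hfq _ hbj]
        · exact h.symm

/-- If `w` lies in only one of the first `n` triangles, the edges shared by these triangles avoid
`w`. -/
theorem rationalPoint_of_sharesEdge {n : ℕ} {j : Fin m} {w : V}
    (hw : ∀ k : Fin m, k.val < n → k ≠ j → w ∉ T k) {i : Fin m} (hi : i.val < n) (k l : Fin m)
    (hl : l ≤ i) (hkl : k < l) (_ : SharesEdge (T k) (T l)) (u : V) (huk : u ∈ T k)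
    (hul : u ∈ T l) : RationalPoint (fieldWithout p w) (p u) := by
  apply mem_fieldWithout
  rintro rfl
  have hln : l.val < n := lt_of_le_of_lt hl hi
  by_cases h : l = j
  · exact hw k (lt_trans hkl hln) (fun h' => hkl.ne (h'.trans h.symm)) huk
  · exact hw l hln h hul

section Unfolding

variable {f : Fin m → Plane → Plane}

/-- If all leaves are moved by the same map, then so are all triangles. -/
theorem eq_of_eq_on_leaves (hT : IsTriangleTree T) (hp : IsGenericConfig p)
    (hf : ∀ i, ∀ u ∈ T i, f i (p u) = q u)
    (hfK : ∀ i, ∀ K : IntermediateField ℚ ℝ,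
      (∀ j k : Fin m, k ≤ i → j < k → SharesEdge (T j) (T k) → ∀ u ∈ T j, u ∈ T k →
        RationalPoint K (p u)) → RationalAffine K (f i))
    (n : ℕ) (hn : 2 ≤ n) (h : Plane → Plane) :
    n ≤ m → (∀ k, IsLeafAmong T n k → f k = h) → ∀ k : Fin m, k.val < n → f k = h := by
  induction n, hn using Nat.le_induction with
  | base =>
    intro hm hl k hk
    apply hl
    obtain ⟨j, hjk, hj⟩ := hT.exists_isLeafAmong_ne 2 le_rfl hm k
    obtain ⟨l, hlk, hl'⟩ := hT.exists_isLeafAmong_ne 2 le_rfl hm j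
    have h1 := hj.1
    have h2 := hl'.1
    have h3 : l.val ≠ j.val := fun h => hlk (Fin.ext h)
    have h4 : j.val ≠ k.val := fun h => hjk (Fin.ext h)
    obtain rfl : l = k := Fin.ext (by omega)
    exact hl'
  | succ n hn ih =>
    intro hm hleaf
    obtain ⟨i, hin⟩ : ∃ i : Fin m, i.val = n := ⟨⟨n, by omega⟩, rfl⟩
    subst hin
    obtain ⟨j, hj, hs⟩ := hT.exists_parent (i := i) (by omega)
    have hi : f i = h := hleaf i (hT.isLeafAmong_last (by omega))
    -- When `T i` is removed, only its parent can become a new leaf.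
    have hold : ∀ k, IsLeafAmong T i.val k → f k = h := by
      intro k hk
      by_cases hkj : k = j
      · subst hkj
        obtain ⟨k', hk'k, hk'⟩ := hT.exists_isLeafAmong_ne i.val hn (by omega) k
        have hf' : f k' = h := hleaf k' (hT.isLeafAmong_succ hj hs hk' hk'k)
        obtain ⟨hki, l, ⟨hl1, hl2, hl3⟩, hu⟩ := hk
        -- The knot `w` of the new leaf lies in `T i` too, so `f k` and `h` agree at `p w`. Among
        -- the remaining triangles only `T k` contains `w`, so `f k` and `f k' = h` both have
        -- coefficients over the field without `p w`.
        obtain ⟨w, hwk, hwl⟩ := hT.exists_mem_notMem hl3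
        have hw := hT.notMem_of_leaf hki (fun k h1 h2 h3 => hu k ⟨h1, h2, h3⟩) hwk hwl
        have hwi := hT.mem_of_sharesEdge hj hl1 hl2 hl3 hs hwk hwl
        rw [← hf']
        refine (hfK k _ (rationalPoint_of_sharesEdge hw hki)).eq_of_apply_eq
          (hfK k' _ (rationalPoint_of_sharesEdge hw hk'.1)) (hp.quadraticallyGeneric w) ?_
        rw [hf k w hwk, hf', ← hi, hf i w hwi]
      · exact hleaf k (hT.isLeafAmong_succ hj hs hk hkj)
    intro k hk
    rcases Nat.lt_succ_iff_lt_or_eq.1 hk with h' | h'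
    · exact ih (by omega) hold k h'
    · rw [Fin.ext h', hi]

/-- If the distances between leaf knots are kept, then all leaves are moved by the same map. -/
theorem eq_of_isLeafAmong (hT : IsTriangleTree T) (hp : IsGenericConfig p)
    (hf : ∀ i, ∀ u ∈ T i, f i (p u) = q u)
    (hfK : ∀ i, ∀ K : IntermediateField ℚ ℝ,
      (∀ j k : Fin m, k ≤ i → j < k → SharesEdge (T j) (T k) → ∀ u ∈ T j, u ∈ T k →
        RationalPoint K (p u)) → RationalAffine K (f i))
    (hd : ∀ u w, IsLeafKnot T u → IsLeafKnot T w → dist (q u) (q w) = dist (p u) (p w))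
    {i k : Fin m} (hi : IsLeafAmong T m i) (hk : IsLeafAmong T m k) : f i = f k := by
  by_cases hik : i = k
  · rw [hik]
  have knot : ∀ i, IsLeafAmong T m i →
      ∃ w ∈ T i, IsLeafKnot T w ∧ ∀ k : Fin m, k.val < m → k ≠ i → w ∉ T k := by
    rintro i ⟨hi, l, ⟨hl1, hl2, hl3⟩, hu⟩
    obtain ⟨w, hwi, hwl⟩ := hT.exists_mem_notMem hl3
    exact ⟨w, hwi, ⟨i, ⟨l, ⟨hl2, hl3⟩, fun k hk => hu k ⟨k.2, hk⟩⟩, hwi, l, hl2, hl3, hwl⟩,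
      hT.notMem_of_leaf hi (fun k h1 h2 h3 => hu k ⟨h1, h2, h3⟩) hwi hwl⟩
  obtain ⟨u, hui, hu, hu'⟩ := knot i hi
  obtain ⟨w, hwk, hw, hw'⟩ := knot k hk
  have hwu : w ≠ u := by
    rintro rfl
    exact hu' k hk.1 (Ne.symm hik) hwk
  have hpw : RationalPoint (fieldWithout p u) (p w) := mem_fieldWithout p hwu
  have hqw : RationalPoint (fieldWithout p u) (q w) := by
    rw [← hf k w hwk]
    exact (hfK k _ (rationalPoint_of_sharesEdge hu' hk.1)).rationalPoint hpw
  -- Neither `f i` nor `q w` involves `p u`, so the equation `|f i z - q w| = |z - p w|`, true at `p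
  -- u`, holds for all `z`. At `z = p w` it gives `f i (p w) = q w = f k (p w)`, and neither map
  -- involves `p w`.
  have h := (hfK i _ (rationalPoint_of_sharesEdge hu' hi.1)).dist_eq (hp.quadraticallyGeneric u)
    hqw hpw (by rw [hf i u hui]; exact hd u w hu hw) (p w)
  rw [dist_self, dist_eq_zero] at h
  exact (hfK i _ (rationalPoint_of_sharesEdge hw' hi.1)).eq_of_apply_eq
    (hfK k _ (rationalPoint_of_sharesEdge hw' hk.1)) (hp.quadraticallyGeneric w)
    (by rw [h, hf k w hwk])

end Unfolding

end IsTriangleTree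

/-! ### Global rigidity of triangle notches -/

/-- A triangle notch is rigid among the placements that fix the first triangle. -/
theorem IsTriangleNotchOf.eq_of_eq_on_first {V : Type*} [DecidableEq V] {G : SimpleGraph V}
    {m : ℕ} {T : Fin m → Finset V} {v : V} (hG : IsTriangleNotchOf G T v) {p q : V → Plane}
    (hp : IsGenericConfig p) (hq : SameEdgeLengths G p q)
    (h0 : ∀ i : Fin m, i.val = 0 → ∀ u ∈ T i, q u = p u) : q = p := by
  have hT := hG.tree
  have hne : ∀ i, ∀ u ∈ T i, u ≠ v := fun i u hu h => hG.apex_outside i (h ▸ hu)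
  have hqT : ∀ i, ∀ u ∈ T i, ∀ w ∈ T i, dist (q u) (q w) = dist (p u) (p w) := by
    intro i u hu w hw
    by_cases huw : u = w
    · rw [huw, dist_self, dist_self]
    · exact hq u w ((hG.adj_iff u w (hne i u hu) (hne i w hw)).2 ⟨huw, i, hu, hw⟩)
  choose f hfi hf hfK using hT.exists_rationalAffine hp hqT h0
  obtain ⟨S, hS, hSv⟩ := hG.extended
  obtain ⟨a, b, c, ha, hb, hc, hab, hac, hbc⟩ := Finset.two_lt_card_iff.1 hS
  have hva := (hSv a ha).1
  have hvb := (hSv b hb).1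
  have hvc := (hSv c hc).1
  have harea := hp.signedArea_ne_zero hab hac hbc
  have hP : ∀ u : {u // G.Adj v u}, RationalPoint (fieldWithout p v) (p u.1) := fun u =>
    mem_fieldWithout p u.2.ne.symm
  have hQ : ∀ u : {u // G.Adj v u}, RationalPoint (fieldWithout p v) (q u.1) := by
    intro u
    obtain ⟨i, hi⟩ := hG.covers u.1 u.2.ne.symm
    rw [← hf i u.1 hi]
    exact (hfK i _ fun j k _ _ _ w hw _ => mem_fieldWithout p (hne j w hw)).rationalPoint (hP u)
  have hnbr := (hp.quadraticallyGeneric v).dist_eq_of_trilateration (y := q v) hP hQ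
    (a := ⟨a, hva⟩) (b := ⟨b, hvb⟩) (c := ⟨c, hvc⟩) harea (fun u => hq v u.1 u.2)
  have hid : ∀ i : Fin m, i.val = 0 → f i = id := by
    intro i hi
    obtain ⟨u, hu⟩ : (T i).Nonempty := by
      rw [← Finset.card_pos, hT.card_eq_three]
      norm_num
    -- No edge is shared before the second triangle, so the condition on the field is vacuous.
    refine (hfK i _ fun j k hk hj => ?_).eq_of_apply_eq RationalAffine.id
      (hp.quadraticallyGeneric u) ?_
    · have h1 : j.val < k.val := hj
      have h2 : k.val ≤ i.val := hk
      omega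
    · rw [hf i u hu, h0 i hi u hu, id]
  have hall : ∀ i, f i = id := by
    intro i
    -- Leaves exist only from two triangles on; a single triangle is the first one.
    rcases lt_or_ge m 2 with hm | hm
    · exact hid i (by omega)
    · let z : Fin m := ⟨0, by omega⟩
      obtain ⟨k, -, hk⟩ := hT.exists_isLeafAmong_ne m hm le_rfl z
      have hleaf : ∀ j, IsLeafAmong T m j → f j = f k := fun j hj =>
        hT.eq_of_isLeafAmong hp hf hfK (fun u w hu hw =>
          hnbr ⟨u, hG.leafKnots_adj u hu⟩ ⟨w, hG.leafKnots_adj w hw⟩) hj hk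
      have h := hT.eq_of_eq_on_leaves hp hf hfK m hm (f k) le_rfl hleaf
      rw [h i i.2, ← h z z.2, hid z rfl]
  have hold : ∀ u, u ≠ v → q u = p u := by
    intro u hu
    obtain ⟨i, hi⟩ := hG.covers u hu
    rw [← hf i u hi, hall, id]
  have hd : ∀ u, G.Adj v u → dist (q v) (p u) = dist (p v) (p u) := fun u hu => by
    rw [← hold u hu.ne.symm, hq v u hu, hold u hu.ne.symm]
  funext u
  by_cases hu : u = v
  · rw [hu]
    exact eq_of_dist_eq_of_signedArea_ne_zero harea (hd a hva) (hd b hvb) (hd c hvc)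
  · exact hold u hu

theorem lemma4 {V : Type*} [DecidableEq V] (G : SimpleGraph V) (hG : IsTriangleNotch G) :
    GenericallyGloballyRigid G := by
  obtain ⟨m, T, v, hG⟩ := hG
  intro p hp q hq
  have hT := hG.tree
  have hm : 0 < m := by
    obtain ⟨S, hS, hSv⟩ := hG.extended
    obtain ⟨u, hu⟩ : S.Nonempty := Finset.card_pos.1 (by omega)
    obtain ⟨i, -⟩ := hG.covers u (hSv u hu).1.ne.symm
    exact i.pos
  obtain ⟨a, b, c, hab, hac, hbc, he⟩ := Finset.card_eq_three.1 (hT.card_eq_three ⟨0, hm⟩)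
  have hd : ∀ u ∈ T ⟨0, hm⟩, ∀ w ∈ T ⟨0, hm⟩, u ≠ w → dist (q u) (q w) = dist (p u) (p w) :=
    fun u hu w hw huw => hq u w ((hG.adj_iff u w (fun h => hG.apex_outside _ (h ▸ hu))
      (fun h => hG.apex_outside _ (h ▸ hw))).2 ⟨huw, _, hu, hw⟩)
  rw [he] at hd
  have h1 := hd a (by simp) b (by simp) hab
  have h2 := hd c (by simp) a (by simp) hac.symm
  have h3 := hd c (by simp) b (by simp) hbc.symm
  -- The normalising isometry carries `q` to `p`, so the triangle of `q` has to be non-degenerate.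
  have harea : signedArea (q a) (q b) (q c) ≠ 0 := by
    intro h
    apply hp.signedArea_ne_zero hab hac hbc
    rw [← sq_eq_zero_iff, ← signedArea_sq_eq h1 h2 h3, h, zero_pow two_ne_zero]
  obtain ⟨e, hei, hea, heb, hec⟩ := exists_isometry_of_triangle harea h1.symm h2.symm h3.symm
  have heq : e ∘ q = p := by
    refine hG.eq_of_eq_on_first hp (fun u w h => (hei.dist_eq _ _).trans (hq u w h)) ?_
    intro i hi u hu
    obtain rfl : i = ⟨0, hm⟩ := Fin.ext hi
    simp only [he, Finset.mem_insert, Finset.mem_singleton] at hu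
    rcases hu with rfl | rfl | rfl
    exacts [hea, heb, hec]
  intro u w
  rw [← hei.dist_eq, ← heq]
  rfl
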